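/- Let $\mathcal C$ and $\mathcal D$ be monoidal categories with tensor product $\otimes$ and unit object $I$ (denoted $I_{\mathcal C}$, $I_{\mathcal D}$), let $(R,\Phi,\phi)\colon\mathcal C\to\mathcal D$ be a (lax) monoidal functor, and let $L\colon\mathcal D\to\mathcal C$ be a left adjoint of $R$, with unit $\kappa\colon \mathrm{id}\Rightarrow RL$ and counit $\lambda\colon LR\Rightarrow\mathrm{id}$. Let $\psi\colon LI_{\mathcal D}\to I_{\mathcal C}$ and $\Psi_{X,Y}\colon L(X\otimes Y)\to LX\otimes LY$ be the opmonoidal structure induced on $L$, that is, the adjoint transposes of $\phi$ and of $\Phi_{LX,LY}\circ(\kappa_X\otimes\kappa_Y)$. Assume that $\mathcal C$ has coequalizers, that these are preserved by the functors $C\otimes-$ and $-\otimes C$ for each object $C$ of $\mathcal C$, and that the forgetful functor $|-|\colon\mathbf{Mon}\,\mathcal C\to\mathcal C$ from the category of monoids in $\mathcal C$ has a left adjoint $T$, with unit $\xi$ and counit $\zeta$. Write $m_{TY}$ and $e_{TY}$ for the multiplication and unit of the free monoid $TY$. Then the functor $\bar R\colon\mathbf{Mon}\,\mathcal C\to\mathbf{Mon}\,\mathcal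 D$ induced by $R$ has a left adjoint. More precisely, for each monoid $\mathsf D=(D,m_{\mathsf D},e_{\mathsf D})$ in $\mathcal D$ consider the $\mathcal C$-morphisms $$\alpha_1^{\mathsf D}=e_{TLD}\circ\psi,\qquad \beta_1^{\mathsf D}=\xi_{LD}\circ Le_{\mathsf D}\qquad\colon LI_{\mathcal D}\to|TLD|,$$ $$\alpha_2^{\mathsf D}=m_{TLD}\circ(\xi_{LD}\otimes\xi_{LD})\circ\Psi_{D,D},\qquad \beta_2^{\mathsf D}=\xi_{LD}\circ Lm_{\mathsf D}\qquad\colon L(D\otimes D)\to|TLD|,$$ and let $\bar\alpha_1^{\mathsf D},\bar\beta_1^{\mathsf D}\colon TLI_{\mathcal D}\to TLD$ and $\bar\alpha_2^{\mathsf D},\bar\beta_2^{\mathsf D}\colon TL(D\otimes D)\to TLD$ be the unique monoid morphisms that extend them along $\xi$. There exist a left adjoint $\bar L$ of $\bar R$ and monoid morphisms $\pi_{\mathsf D}\colon TLD\to\bar L\mathsf D$, natural in $\mathsf D$, such that 1. for each monoid $\mathsf D$ in $\mathcal D$, $\pi_{\mathsf D}$ is, in $\mathbf{Mon}\,\mathcal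 C$, a multiple coequalizer of the pairs $(\bar\alpha_1^{\mathsf D},\bar\beta_1^{\mathsf D})$ and $(\bar\alpha_2^{\mathsf D},\bar\beta_2^{\mathsf D})$, i.e. $\pi_{\mathsf D}\circ\bar\alpha_i^{\mathsf D}=\pi_{\mathsf D}\circ\bar\beta_i^{\mathsf D}$ for $i=1,2$, and each monoid morphism $\tau$ on $TLD$ with $\tau\circ\bar\alpha_i^{\mathsf D}=\tau\circ\bar\beta_i^{\mathsf D}$ for $i=1,2$ factors uniquely through $\pi_{\mathsf D}$; 2. the unit $\gamma$ of the adjunction $\bar L\dashv\bar R$ has underlying $\mathcal D$-morphisms $|\gamma_{\mathsf D}|=R|\pi_{\mathsf D}|\circ R\xi_{LD}\circ\kappa_D$; 3. the counit $\sigma$ of the adjunction $\bar L\dashv\bar R$ satisfies $\sigma_{\mathsf A}\circ\pi_{\bar R\mathsf A}=\zeta_{\mathsf A}\circ T\lambda_{|\mathsf A|}$ for each monoid $\mathsf A$ in $\mathcal C$. -/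

import Mathlib

open CategoryTheory MonoidalCategory

universe v₁ v₂ u₁ u₂

namespace MonLift

/-- `π : A ⟶ Q` is a multiple coequalizer (the joint coequalizer) of the two parallel pairs
`f₁, g₁ : X₁ ⟶ A` and `f₂, g₂ : X₂ ⟶ A`. -/
def IsMultipleCoequalizer {E : Type u₁} [Category.{v₁} E] {X₁ X₂ A Q : E}
    (f₁ g₁ : X₁ ⟶ A) (f₂ g₂ : X₂ ⟶ A) (π : A ⟶ Q) : Prop :=
  f₁ ≫ π = g₁ ≫ π ∧ f₂ ≫ π = g₂ ≫ π ∧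
    ∀ (Z : E) (τ : A ⟶ Z), f₁ ≫ τ = g₁ ≫ τ → f₂ ≫ τ = g₂ ≫ τ → ∃! σ : Q ⟶ Z, π ≫ σ = τ

/-- The tensor product of `E` preserves coequalizers in each variable separately. -/
def TensorPreservesCoequalizers (E : Type u₁) [Category.{v₁} E] [MonoidalCategory E] : Prop :=
  ∀ X : E,
    Limits.PreservesColimitsOfShape Limits.WalkingParallelPair (tensorLeft X) ∧
      Limits.PreservesColimitsOfShape Limits.WalkingParallelPair (tensorRight X)

section

variable {C : Type u₁} [Category.{v₁} C] [MonoidalCategory C]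
  {D : Type u₂} [Category.{v₂} D] [MonoidalCategory D]
  {R : C ⥤ D} [R.LaxMonoidal] {L : D ⥤ C} (adj : L ⊣ R)
  {T : C ⥤ Mon C} (adjT : T ⊣ Mon.forget C)

/-- The counit `ψ : L I ⟶ I` of the opmonoidal structure that `L` inherits from `R`. -/
def opUnit : L.obj (𝟙_ D) ⟶ 𝟙_ C :=
  letI := adj.leftAdjointOplaxMonoidal
  Functor.OplaxMonoidal.η L

/-- The comultiplication `Ψ : L (X ⊗ Y) ⟶ L X ⊗ L Y` of the opmonoidal structure that `L`
inherits from `R`. -/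
def opMul (X Y : D) : L.obj (X ⊗ Y) ⟶ L.obj X ⊗ L.obj Y :=
  letI := adj.leftAdjointOplaxMonoidal
  Functor.OplaxMonoidal.δ L X Y

/-- The unit `ξ` of the adjunction `T ⊣ |-|`, as a morphism `Y ⟶ |T Y|` of `C`. -/
def freeUnit (Y : C) : Y ⟶ (T.obj Y).X :=
  adjT.unit.app Y

/-- The homomorphic extension `T Y ⟶ A` of a morphism `f : Y ⟶ |A|` of `C`. -/
def extend {Y : C} {A : Mon C} (f : Y ⟶ A.X) : T.obj Y ⟶ A :=
  (adjT.homEquiv Y A).symm f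

/-- `L I ⟶ I ⟶ |T L M|`, through the unit of the free monoid. -/
def α₁ (M : Mon D) : L.obj (𝟙_ D) ⟶ (T.obj (L.obj M.X)).X :=
  opUnit adj ≫ MonObj.one

/-- `L I ⟶ L M ⟶ |T L M|`, through the unit of the monoid `M`. -/
def β₁ (M : Mon D) : L.obj (𝟙_ D) ⟶ (T.obj (L.obj M.X)).X :=
  L.map MonObj.one ≫ freeUnit adjT (L.obj M.X)

/-- `L (M ⊗ M) ⟶ L M ⊗ L M ⟶ |T L M| ⊗ |T L M| ⟶ |T L M|`, through the multiplication of the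
free monoid. -/
def α₂ (M : Mon D) : L.obj (M.X ⊗ M.X) ⟶ (T.obj (L.obj M.X)).X :=
  opMul adj M.X M.X ≫ (freeUnit adjT (L.obj M.X) ⊗ₘ freeUnit adjT (L.obj M.X)) ≫ MonObj.mul

/-- `L (M ⊗ M) ⟶ L M ⟶ |T L M|`, through the multiplication of the monoid `M`. -/
def β₂ (M : Mon D) : L.obj (M.X ⊗ M.X) ⟶ (T.obj (L.obj M.X)).X :=
  L.map MonObj.mul ≫ freeUnit adjT (L.obj M.X)

end

end MonLift

namespace MonLift

open MonObj

/-! By the composite of `adj` and `adjT`, monoid morphisms `T L M ⟶ A` correspond to `D`-morphisms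
`M ⟶ R |A|`. Since `ψ` and `Ψ` are transposes of the lax structure of `R`, coequalizing the two
pairs means precisely that the transpose preserves unit and multiplication. Hence a multiple
coequalizer represents `A ↦ Hom(M, R A)`, and these objects assemble into the left adjoint. It
exists because a monoid can be divided by relations `f = g` (`exists_quotient`): take the
coequalizer in `C` of the translates `a * f y * b` and `a * g y * b`. Tensoring preserves it, so the
multiplication descends. -/

theorem epi_map_coequalizer_π {C : Type u₁} [Category.{v₁} C] {X A : C} {f g : X ⟶ A}
    [Limits.HasCoequalizer f g] (F : C ⥤ C)
    [Limits.PreservesColimitsOfShape Limits.WalkingParallelPair F] :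
    Epi (F.map (Limits.coequalizer.π f g)) :=
  Limits.epi_of_isColimit_cofork (Limits.isColimitCoforkMapOfIsColimit F
    (Limits.coequalizer.condition f g) (Limits.coequalizerIsCoequalizer f g))

/-! ### Quotients of monoids by relations -/

section Quotient

variable {C : Type u₁} [Category.{v₁} C] [MonoidalCategory C]

section Whiskering

variable {X A : C} {f g : X ⟶ A} [Limits.HasCoequalizer f g]

theorem whiskerRight_coequalizer_desc (hC : TensorPreservesCoequalizers C) (B : C) {W : C} (s : A ⊗ B ⟶ W)
    (hs : f ▷ B ≫ s = g ▷ B ≫ s) :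
    ∃ t : Limits.coequalizer f g ⊗ B ⟶ W, Limits.coequalizer.π f g ▷ B ≫ t = s := by
  have := (hC B).2
  have h := Limits.isColimitCoforkMapOfIsColimit (tensorRight B)
    (Limits.coequalizer.condition f g) (Limits.coequalizerIsCoequalizer f g)
  exact ⟨_, (Limits.Cofork.IsColimit.desc' h s hs).2⟩

theorem whiskerLeft_coequalizer_desc (hC : TensorPreservesCoequalizers C) (B : C) {W : C} (s : B ⊗ A ⟶ W)
    (hs : B ◁ f ≫ s = B ◁ g ≫ s) :
    ∃ t : B ⊗ Limits.coequalizer f g ⟶ W, B ◁ Limits.coequalizer.π f g ≫ t = s := by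
  have := (hC B).1
  have h := Limits.isColimitCoforkMapOfIsColimit (tensorLeft B)
    (Limits.coequalizer.condition f g) (Limits.coequalizerIsCoequalizer f g)
  exact ⟨_, (Limits.Cofork.IsColimit.desc' h s hs).2⟩

theorem epi_whiskerRight_coequalizer_π (hC : TensorPreservesCoequalizers C) (B : C) : Epi (Limits.coequalizer.π f g ▷ B) :=
  have := (hC B).2
  epi_map_coequalizer_π (tensorRight B)

theorem epi_whiskerLeft_coequalizer_π (hC : TensorPreservesCoequalizers C) (B : C) : Epi (B ◁ Limits.coequalizer.π f g) :=
  have := (hC B).1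
  epi_map_coequalizer_π (tensorLeft B)

theorem epi_whiskerLeft_coequalizer_π_whiskerRight (hC : TensorPreservesCoequalizers C) (B B' : C) :
    Epi ((B ◁ Limits.coequalizer.π f g) ▷ B') :=
  have := (hC B).1
  have := (hC B').2
  epi_map_coequalizer_π (tensorLeft B ⋙ tensorRight B')

theorem epi_coequalizer_π_whiskerRight_whiskerRight (hC : TensorPreservesCoequalizers C) (B B' : C) :
    Epi ((Limits.coequalizer.π f g ▷ B) ▷ B') :=
  have := (hC B).2
  have := (hC B').2
  epi_map_coequalizer_π (tensorRight B ⋙ tensorRight B')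

end Whiskering

/-- The two-sided translate `(a, y, b) ↦ a * f y * b` of a morphism `f : Y ⟶ A` into a monoid. -/
def twoSided {Y : C} (A : C) [MonObj A] (f : Y ⟶ A) : (A ⊗ Y) ⊗ A ⟶ A :=
  (A ◁ f) ▷ A ≫ μ ▷ A ≫ μ

/-- By associativity the extra right factor is absorbed into the last slot. With its mirror image
below, this makes the relations stable under multiplication, like a two-sided ideal. -/
theorem twoSided_whiskerRight_mul {Y : C} (A : C) [MonObj A] (f : Y ⟶ A) :
    twoSided A f ▷ A ≫ μ = (α_ _ _ _).hom ≫ (A ⊗ Y) ◁ μ ≫ twoSided A f := by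
  simp only [twoSided, comp_whiskerRight, Category.assoc]
  conv_lhs => rw [MonObj.mul_assoc]
  rw [associator_naturality_left_assoc, associator_naturality_left_assoc,
    whisker_exchange_assoc, whisker_exchange_assoc]

theorem whiskerLeft_twoSided_mul {Y : C} (A : C) [MonObj A] (f : Y ⟶ A) :
    A ◁ twoSided A f ≫ μ =
      (α_ _ _ _).inv ≫ (α_ _ _ _).inv ▷ A ≫ (μ ▷ Y) ▷ A ≫ twoSided A f := by
  have h : A ◁ μ[A] ≫ μ = (α_ A A A).inv ≫ μ ▷ A ≫ μ := by simp
  simp only [twoSided, MonoidalCategory.whiskerLeft_comp, Category.assoc, h]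
  simp only [associator_inv_naturality_middle_assoc, ← comp_whiskerRight_assoc, h,
    associator_inv_naturality_right_assoc, whisker_exchange_assoc]

theorem twoSided_unit {Y : C} (A : C) [MonObj A] (f : Y ⟶ A) :
    (λ_ Y).inv ≫ (ρ_ _).inv ≫ (η[A] ▷ Y) ▷ 𝟙_ C ≫ (A ⊗ Y) ◁ η[A] ≫ twoSided A f = f := by
  rw [twoSided, whisker_exchange_assoc, whisker_exchange_assoc, mul_one,
    rightUnitor_naturality, rightUnitor_naturality_assoc, rightUnitor_naturality_assoc,
    Iso.inv_hom_id_assoc, ← whisker_exchange_assoc, one_mul, leftUnitor_naturality,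
    Iso.inv_hom_id_assoc]

theorem twoSided_comp {Y : C} {A B : Mon C} (f : Y ⟶ A.X) (τ : A ⟶ B) :
    twoSided A.X f ≫ τ.hom =
      (τ.hom ▷ Y) ▷ A.X ≫ (B.X ⊗ Y) ◁ τ.hom ≫ twoSided B.X (f ≫ τ.hom) := by
  simp only [twoSided, Category.assoc, IsMonHom.mul_hom, MonoidalCategory.tensorHom_def,
    ← comp_whiskerRight_assoc, MonoidalCategory.whiskerLeft_comp]
  simp only [comp_whiskerRight, Category.assoc, whisker_exchange_assoc]

variable [Limits.HasCoequalizers C]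

theorem exists_quotient (hC : TensorPreservesCoequalizers C) (A : Mon C) {Y : C}
    (f g : Y ⟶ A.X) :
    ∃ (Q : Mon C) (q : A ⟶ Q), f ≫ q.hom = g ≫ q.hom ∧
      ∀ (Z : Mon C) (τ : A ⟶ Z), f ≫ τ.hom = g ≫ τ.hom → ∃! σ : Q ⟶ Z, q ≫ σ = τ := by
  let Q := Limits.coequalizer (twoSided A.X f) (twoSided A.X g)
  let q : A.X ⟶ Q := Limits.coequalizer.π _ _
  have hq : twoSided A.X f ≫ q = twoSided A.X g ≫ q := Limits.coequalizer.condition _ _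
  have epiL (B : C) : Epi (B ◁ q) := epi_whiskerLeft_coequalizer_π hC B
  have epiR (B : C) : Epi (q ▷ B) := epi_whiskerRight_coequalizer_π hC B
  -- The multiplication descends one variable at a time, first the left factor, then the right.
  obtain ⟨t, ht⟩ : ∃ t : Q ⊗ A.X ⟶ Q, q ▷ A.X ≫ t = μ ≫ q := by
    apply whiskerRight_coequalizer_desc hC
    simp only [reassoc_of% twoSided_whiskerRight_mul, hq]
  obtain ⟨m, hm⟩ : ∃ m : Q ⊗ Q ⟶ Q, Q ◁ q ≫ m = t := by
    apply whiskerLeft_coequalizer_desc hC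
    rw [← cancel_epi (q ▷ _), ← whisker_exchange_assoc, ← whisker_exchange_assoc, ht]
    simp only [reassoc_of% whiskerLeft_twoSided_mul, hq]
  have hqm : q ▷ A.X ≫ Q ◁ q ≫ m = μ ≫ q := by rw [hm, ht]
  let monQ : MonObj Q :=
    { one := η ≫ q
      mul := m
      one_mul := by
        rw [← cancel_epi (𝟙_ C ◁ q), whisker_exchange_assoc, comp_whiskerRight, Category.assoc,
          hqm]
        simp
      mul_one := by
        rw [← cancel_epi (q ▷ 𝟙_ C), ← whisker_exchange_assoc,
          MonoidalCategory.whiskerLeft_comp, Category.assoc, whisker_exchange_assoc, hqm]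
        simp
      mul_assoc := by
        have := epi_whiskerLeft_coequalizer_π_whiskerRight hC Q A.X
          (f := twoSided A.X f) (g := twoSided A.X g)
        have := epi_coequalizer_π_whiskerRight_whiskerRight hC A.X A.X
          (f := twoSided A.X f) (g := twoSided A.X g)
        -- Three epimorphisms, one per tensor factor, pull associativity back to that of `A`.
        rw [← cancel_epi ((Q ⊗ Q) ◁ q), ← cancel_epi ((Q ◁ q) ▷ A.X),
          ← cancel_epi ((q ▷ A.X) ▷ A.X)]
        trans (μ ▷ A.X ≫ μ) ≫ q
        · rw [whisker_exchange_assoc]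
          simp only [← comp_whiskerRight_assoc, Category.assoc, hqm]
          rw [comp_whiskerRight, Category.assoc, hqm]
        · rw [MonObj.mul_assoc, associator_naturality_right_assoc, associator_naturality_middle_assoc,
            associator_naturality_left_assoc]
          simp only [← MonoidalCategory.whiskerLeft_comp_assoc, Category.assoc]
          rw [hqm, MonoidalCategory.whiskerLeft_comp_assoc, ← whisker_exchange_assoc, hqm] }
  let p : A ⟶ (⟨Q⟩ : Mon C) := Mon.Hom.mk' q rfl (by
    rw [MonoidalCategory.tensorHom_def, Category.assoc]
    exact hqm.symm)
  refine ⟨⟨Q⟩, p, ?_, fun Z τ hτ => ?_⟩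
  -- Units in the outer slots recover `f` and `g` from their translates.
  · rw [← twoSided_unit A.X f, ← twoSided_unit A.X g]
    simp only [Category.assoc]
    rw [show twoSided A.X f ≫ p.hom = twoSided A.X g ≫ p.hom from hq]
  · have hd : twoSided A.X f ≫ τ.hom = twoSided A.X g ≫ τ.hom := by
      rw [twoSided_comp, twoSided_comp, hτ]
    let d : Q ⟶ Z.X := Limits.coequalizer.desc τ.hom hd
    have hqd : q ≫ d = τ.hom := Limits.coequalizer.π_desc _ _
    refine ⟨Mon.Hom.mk' d ?_ ?_, ?_, fun σ hσ => ?_⟩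
    · change (η ≫ q) ≫ d = η
      simp [hqd]
    · change m ≫ d = _
      rw [← cancel_epi (Q ◁ q), ← cancel_epi (q ▷ A.X), reassoc_of% hqm, hqd, IsMonHom.mul_hom,
        ← hqd]
      simp only [MonoidalCategory.tensorHom_def, comp_whiskerRight, MonoidalCategory.whiskerLeft_comp,
        Category.assoc, whisker_exchange_assoc]
    · ext
      exact hqd
    · ext
      exact (congrArg Mon.Hom.hom hσ).trans hqd.symm

end Quotient

section Free

variable {C : Type u₁} [Category.{v₁} C] [MonoidalCategory C]
  {T : C ⥤ Mon C} (adjT : T ⊣ Mon.forget C)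

theorem extend_comp_eq_iff {Y : C} {A B : Mon C} (f g : Y ⟶ A.X) (τ : A ⟶ B) :
    extend adjT f ≫ τ = extend adjT g ≫ τ ↔ f ≫ τ.hom = g ≫ τ.hom := by
  have h (k : Y ⟶ A.X) : extend adjT k ≫ τ = (adjT.homEquiv Y B).symm (k ≫ τ.hom) :=
    (adjT.homEquiv_naturality_right_symm k τ).symm
  rw [h, h]
  exact (adjT.homEquiv Y B).symm.apply_eq_iff_eq

theorem exists_isMultipleCoequalizer_extend [Limits.HasCoequalizers C]
    (hC : TensorPreservesCoequalizers C) (A : Mon C) {Y₁ Y₂ : C}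
    (f₁ g₁ : Y₁ ⟶ A.X) (f₂ g₂ : Y₂ ⟶ A.X) :
    ∃ (Q : Mon C) (π : A ⟶ Q), IsMultipleCoequalizer (extend adjT f₁) (extend adjT g₁)
      (extend adjT f₂) (extend adjT g₂) π := by
  obtain ⟨P, p, hp, hp'⟩ := exists_quotient hC A f₁ g₁
  -- The second relation is imposed on the quotient by the first.
  obtain ⟨Q, q, hq, hq'⟩ := exists_quotient hC P (f₂ ≫ p.hom) (g₂ ≫ p.hom)
  refine ⟨Q, p ≫ q, ?_, ?_, fun Z τ h₁ h₂ => ?_⟩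
  · rw [extend_comp_eq_iff, Mon.comp_hom', reassoc_of% hp]
  · rw [extend_comp_eq_iff, Mon.comp_hom']
    simpa using hq
  · rw [extend_comp_eq_iff] at h₁ h₂
    obtain ⟨σ, hσ, hσ'⟩ := hp' Z τ h₁
    obtain ⟨ρ, hρ, hρ'⟩ := hq' Z σ (by simpa [← hσ] using h₂)
    refine ⟨ρ, by simp [hρ, hσ], fun ρ' h => hρ' ρ' (hσ' _ ?_)⟩
    simpa using h

end Free

/-! ### Transposition along the composite adjunction -/

section Transpose

variable {C : Type u₁} [Category.{v₁} C] [MonoidalCategory C]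
  {D : Type u₂} [Category.{v₂} D] {R : C ⥤ D} {L : D ⥤ C} (adj : L ⊣ R)
  {T : C ⥤ Mon C} (adjT : T ⊣ Mon.forget C)

/-- The transpose `M ⟶ R |A|` of a monoid morphism `τ : T L M ⟶ A`. -/
def transpose {X : D} {A : Mon C} (τ : T.obj (L.obj X) ⟶ A) : X ⟶ R.obj A.X :=
  adj.unit.app X ≫ R.map (freeUnit adjT (L.obj X) ≫ τ.hom)

theorem transpose_eq {X : D} {A : Mon C} (τ : T.obj (L.obj X) ⟶ A) :
    transpose adj adjT τ = (adj.comp adjT).homEquiv X A τ := by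
  simp only [transpose, freeUnit, Adjunction.homEquiv_unit, Adjunction.comp_unit_app,
    Category.assoc]
  exact congrArg (adj.unit.app X ≫ ·) (R.map_comp _ _)

theorem transpose_comp {X : D} {A B : Mon C} (τ : T.obj (L.obj X) ⟶ A) (f : A ⟶ B) :
    transpose adj adjT (τ ≫ f) = transpose adj adjT τ ≫ R.map f.hom := by
  simp [transpose]

theorem comp_transpose {X Y : D} {A : Mon C} (f : X ⟶ Y) (τ : T.obj (L.obj Y) ⟶ A) :
    transpose adj adjT (T.map (L.map f) ≫ τ) = f ≫ transpose adj adjT τ := by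
  rw [transpose_eq, transpose_eq]
  exact (adj.comp adjT).homEquiv_naturality_left f τ

theorem transpose_counit (A : Mon C) :
    transpose adj adjT (T.map (adj.counit.app A.X) ≫ adjT.counit.app A) = 𝟙 (R.obj A.X) := by
  rw [transpose_eq]
  have h : T.map (adj.counit.app A.X) ≫ adjT.counit.app A = (adj.comp adjT).counit.app A := by
    simp only [Adjunction.comp_counit_app]
    rfl
  rw [h]
  refine ((adj.comp adjT).homEquiv_unit _ _ _).trans ?_
  exact (adj.comp adjT).right_triangle_components A

theorem transpose_injective {X : D} {A : Mon C} {τ τ' : T.obj (L.obj X) ⟶ A}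
    (h : transpose adj adjT τ = transpose adj adjT τ') : τ = τ' := by
  rw [transpose_eq, transpose_eq] at h
  exact ((adj.comp adjT).homEquiv X A).injective h

end Transpose

section LeftAdjoint

variable {C : Type u₁} [Category.{v₁} C] [MonoidalCategory C]
  {D : Type u₂} [Category.{v₂} D] [MonoidalCategory D]
  {R : C ⥤ D} [R.LaxMonoidal] {L : D ⥤ C} (adj : L ⊣ R)
  {T : C ⥤ Mon C} (adjT : T ⊣ Mon.forget C)

theorem extend_unit_comp_eq_iff (M : Mon D) {A : Mon C} (τ : T.obj (L.obj M.X) ⟶ A) :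
    extend adjT (α₁ adj M) ≫ τ = extend adjT (β₁ adjT M) ≫ τ ↔
      MonObj.one ≫ transpose adj adjT τ = (MonObj.one : _ ⟶ (R.mapMon.obj A).X) := by
  rw [extend_comp_eq_iff, ← (adj.homEquiv _ _).apply_eq_iff_eq, eq_comm]
  have h₁ : (adj.homEquiv _ _) (α₁ adj M ≫ τ.hom) = (MonObj.one : _ ⟶ (R.mapMon.obj A).X) := by
    simp only [α₁, Category.assoc, IsMonHom.one_hom, Adjunction.homEquiv_naturality_right]
    exact congrArg (· ≫ _) ((adj.homEquiv _ _).apply_symm_apply _)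
  have h₂ : (adj.homEquiv _ _) (β₁ adjT M ≫ τ.hom) = MonObj.one ≫ transpose adj adjT τ := by
    simp [β₁, transpose, Adjunction.homEquiv_unit]
  rw [h₁, h₂]

/-- Transposing along `adj` turns the `α₂` side into the product of two copies of the transpose of
`τ`, by naturality of the lax structure `μ` of `R`, and the `β₂` side into the transpose after
multiplication. -/
theorem extend_mul_comp_eq_iff (M : Mon D) {A : Mon C} (τ : T.obj (L.obj M.X) ⟶ A) :
    extend adjT (α₂ adj adjT M) ≫ τ = extend adjT (β₂ adjT M) ≫ τ ↔
      MonObj.mul ≫ transpose adj adjT τ =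
        (transpose adj adjT τ ⊗ₘ transpose adj adjT τ) ≫
          (MonObj.mul : _ ⟶ (R.mapMon.obj A).X) := by
  rw [extend_comp_eq_iff, ← (adj.homEquiv _ _).apply_eq_iff_eq, eq_comm]
  have h₁ : (adj.homEquiv _ _) (α₂ adj adjT M ≫ τ.hom) =
      (transpose adj adjT τ ⊗ₘ transpose adj adjT τ) ≫
        (MonObj.mul : _ ⟶ (R.mapMon.obj A).X) := by
    have h : (adj.homEquiv _ _) (opMul adj M.X M.X) =
        (adj.unit.app M.X ⊗ₘ adj.unit.app M.X) ≫ Functor.LaxMonoidal.μ R _ _ :=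
      (adj.homEquiv _ _).apply_symm_apply _
    rw [α₂, Category.assoc, Adjunction.homEquiv_naturality_right, h, Category.assoc,
      Category.assoc, IsMonHom.mul_hom, MonoidalCategory.tensorHom_comp_tensorHom_assoc, Functor.map_comp,
      ← Functor.LaxMonoidal.μ_natural_assoc, MonoidalCategory.tensorHom_comp_tensorHom_assoc]
    rfl
  have h₂ : (adj.homEquiv _ _) (β₂ adjT M ≫ τ.hom) = MonObj.mul ≫ transpose adj adjT τ := by
    simp [β₂, transpose, Adjunction.homEquiv_unit]
  rw [h₁, h₂]

/-- Morphisms out of the multiple coequalizer are the monoid morphisms into `R A`. -/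
noncomputable def coequalizerHomEquiv (M : Mon D) {Q : Mon C} (π : T.obj (L.obj M.X) ⟶ Q)
    (hπ : IsMultipleCoequalizer (extend adjT (α₁ adj M)) (extend adjT (β₁ adjT M))
      (extend adjT (α₂ adj adjT M)) (extend adjT (β₂ adjT M)) π) (A : Mon C) :
    (Q ⟶ A) ≃ (M ⟶ R.mapMon.obj A) :=
  Equiv.ofBijective
    (fun σ => Mon.Hom.mk' (transpose adj adjT (π ≫ σ))
      ((extend_unit_comp_eq_iff adj adjT M _).1 (by simp only [reassoc_of% hπ.1]))
      ((extend_mul_comp_eq_iff adj adjT M _).1 (by simp only [reassoc_of% hπ.2.1])))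
    (by
      refine ⟨fun σ σ' h => ?_, fun f => ?_⟩
      · have h' : π ≫ σ = π ≫ σ' := transpose_injective adj adjT (congrArg Mon.Hom.hom h)
        exact (hπ.2.2 A (π ≫ σ') (by simp only [reassoc_of% hπ.1])
          (by simp only [reassoc_of% hπ.2.1])).unique h' rfl
      · obtain ⟨τ, hτ⟩ : ∃ τ : T.obj (L.obj M.X) ⟶ A, transpose adj adjT τ = f.hom :=
          ⟨((adj.comp adjT).homEquiv M.X A).symm f.hom, by
            rw [transpose_eq]
            exact Equiv.apply_symm_apply _ _⟩
        obtain ⟨σ, hσ, -⟩ := hπ.2.2 A τ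
          ((extend_unit_comp_eq_iff adj adjT M τ).2 (by rw [hτ]; exact IsMonHom.one_hom f.hom))
          ((extend_mul_comp_eq_iff adj adjT M τ).2 (by rw [hτ]; exact IsMonHom.mul_hom f.hom))
        refine ⟨σ, ?_⟩
        ext
        exact (congrArg (transpose adj adjT) hσ).trans hτ)

end LeftAdjoint

end MonLift

theorem mainTheorem3
    {C : Type u₁} [Category.{v₁} C] [MonoidalCategory C]
    {D : Type u₂} [Category.{v₂} D] [MonoidalCategory D]
    (R : C ⥤ D) [R.LaxMonoidal] (L : D ⥤ C) (adj : L ⊣ R)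
    [Limits.HasCoequalizers C] (hC : MonLift.TensorPreservesCoequalizers C)
    (T : C ⥤ Mon C) (adjT : T ⊣ Mon.forget C) :
    R.mapMon.IsRightAdjoint ∧
      ∃ (Lbar : Mon D ⥤ Mon C) (adjBar : Lbar ⊣ R.mapMon)
        (π : Mon.forget D ⋙ L ⋙ T ⟶ Lbar),
        (∀ M : Mon D,
          MonLift.IsMultipleCoequalizer
            (MonLift.extend adjT (MonLift.α₁ adj M))
            (MonLift.extend adjT (MonLift.β₁ adjT M))
            (MonLift.extend adjT (MonLift.α₂ adj adjT M))
            (MonLift.extend adjT (MonLift.β₂ adjT M))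
            (π.app M)) ∧
        (∀ M : Mon D,
          (adjBar.unit.app M).hom =
            adj.unit.app M.X ≫ R.map (MonLift.freeUnit adjT (L.obj M.X)) ≫
              R.map (π.app M).hom) ∧
        (∀ A : Mon C,
          π.app (R.mapMon.obj A) ≫ adjBar.counit.app A =
            T.map (adj.counit.app A.X) ≫ adjT.counit.app A) := by
  choose Q π hπ using fun M : Mon D =>
    MonLift.exists_isMultipleCoequalizer_extend adjT hC (T.obj (L.obj M.X))
      (MonLift.α₁ adj M) (MonLift.β₁ adjT M) (MonLift.α₂ adj adjT M) (MonLift.β₂ adjT M)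
  let e (M : Mon D) (A : Mon C) : (Q M ⟶ A) ≃ (M ⟶ R.mapMon.obj A) :=
    MonLift.coequalizerHomEquiv adj adjT M (π M) (hπ M) A
  have he' (M : Mon D) (A : Mon C) (σ : Q M ⟶ A) :
      (e M A σ).hom = MonLift.transpose adj adjT (π M ≫ σ) := rfl
  have he (M : Mon D) (A B : Mon C) (g : A ⟶ B) (h : Q M ⟶ A) :
      e M B (h ≫ g) = e M A h ≫ R.mapMon.map g := by
    ext
    rw [he', ← Category.assoc, MonLift.transpose_comp]
    rfl
  let adjBar := Adjunction.adjunctionOfEquivLeft e he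
  have hunit (M : Mon D) : (adjBar.unit.app M).hom = MonLift.transpose adj adjT (π M) := by
    have h : adjBar.unit.app M = e M (Q M) (𝟙 _) := by
      simp [adjBar]
    rw [h, he', Category.comp_id]
  have hcounit (A : Mon C) : MonLift.transpose adj adjT
      (π (R.mapMon.obj A) ≫ adjBar.counit.app A) = 𝟙 (R.obj A.X) := by
    rw [MonLift.transpose_comp, ← hunit]
    exact congrArg Mon.Hom.hom (adjBar.right_triangle_components A)
  refine ⟨adjBar.isRightAdjoint, _, adjBar, ⟨π, fun M N f => ?_⟩, hπ, fun M => ?_, fun A => ?_⟩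
  -- After transposition, naturality of `π` is naturality of the unit of `adjBar`.
  · apply MonLift.transpose_injective adj adjT
    refine (MonLift.comp_transpose adj adjT f.hom (π N)).trans
      (Eq.trans ?_ (MonLift.transpose_comp adj adjT (π M) _).symm)
    rw [← hunit, ← hunit]
    exact congrArg Mon.Hom.hom (adjBar.unit.naturality f)
  · rw [hunit, MonLift.transpose, Functor.map_comp]
  -- Both sides transpose to the identity of `R |A|`.
  · apply MonLift.transpose_injective adj adjT
    exact (hcounit A).trans (MonLift.transpose_counit adj adjT A).symm
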